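/- Let $1\le p<2$. A probability distribution over $r\times n$ real matrices $\Pi$ is an $\ell_p$ oblivious subspace embedding (for dimension $d$) with distortion $\kappa$ if for every fixed $A\in\mathbb{R}^{n\times d}$, $$\Pr_{\Pi}\big[\,\|Ax\|_p\le\|\Pi Ax\|_p\le\kappa\|Ax\|_p\ \text{ for all } x\in\mathbb{R}^d\,\big]\ge 0.99 .$$ (i) There is a constant $c>0$ depending only on $p$ such that for all positive integers $n,d,r$ with $(r,d)\ne(1,1)$, every $\ell_p$ oblivious subspace embedding over $r\times n$ matrices has distortion $$\kappa\ \ge\ \frac{c}{\left(\frac1d\right)^{1/p}\log^{2/p} r+\left(\frac rn\right)^{1/p-1/2}} .$$ (ii) Consequently, for every integer $a\ge 0$ there is a constant $c>0$ depending only on $p$ and $a$ such that for all positive integers $n,d,r$ with $d\ge 2$, $r\le d^{a}$ and $n\ge r\,d^{2/(2-p)}$, every $\ell_p$ oblivious subspace embedding over $r\times n$ matrices has distortion $\kappa\ge c\,d^{1/p}\log^{-2/p}d$. -/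

import Mathlib

/-- The `ℓ_p` norm of a vector in `ℝ^m`. -/
noncomputable def vecLpNorm (p : ℝ) {m : ℕ} (v : Fin m → ℝ) : ℝ :=
  ‖WithLp.toLp (ENNReal.ofReal p) v‖

/-- For `p > 0` the `ℓ_p` norm is given by the usual formula. -/
theorem vecLpNorm_eq_sum {p : ℝ} (hp : 0 < p) {m : ℕ} (v : Fin m → ℝ) :
    vecLpNorm p v = (∑ i, |v i| ^ p) ^ (1 / p) := by
  have h : (ENNReal.ofReal p).toReal = p := ENNReal.toReal_ofReal hp.le
  rw [vecLpNorm, PiLp.norm_eq_sum (by rw [h]; exact hp)]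
  simp only [h, Real.norm_eq_abs]

/-- The event that the `r × n` matrix `M` embeds the column space of `A` with distortion `κ`:
`‖A x‖_p ≤ ‖M A x‖_p ≤ κ ‖A x‖_p` simultaneously for all `x`. -/
def EmbedsColumnSpace (p κ : ℝ) {r n d : ℕ} (M : Matrix (Fin r) (Fin n) ℝ)
    (A : Matrix (Fin n) (Fin d) ℝ) : Prop :=
  ∀ x : Fin d → ℝ,
    vecLpNorm p (A.mulVec x) ≤ vecLpNorm p (M.mulVec (A.mulVec x)) ∧
      vecLpNorm p (M.mulVec (A.mulVec x)) ≤ κ * vecLpNorm p (A.mulVec x)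

/-- The product (equivalently, Borel) `σ`-algebra on `r × n` real matrices. -/
instance instMeasurableSpaceRealMatrix (r n : ℕ) :
    MeasurableSpace (Matrix (Fin r) (Fin n) ℝ) :=
  inferInstanceAs (MeasurableSpace (Fin r → Fin n → ℝ))

/-- A probability distribution `μ` over `r × n` real matrices is an `ℓ_p` oblivious subspace
embedding with distortion `κ` (for subspaces spanned by `d` vectors of `ℝ^n`): for every fixed
`A ∈ ℝ^{n × d}`, a random matrix drawn from `μ` embeds the column space of `A` with distortion `κ`
with probability at least `0.99`. -/
def IsObliviousSubspaceEmbedding (p κ : ℝ) (r n d : ℕ)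
    (μ : MeasureTheory.Measure (Matrix (Fin r) (Fin n) ℝ)) : Prop :=
  MeasureTheory.IsProbabilityMeasure μ ∧
    ∀ A : Matrix (Fin n) (Fin d) ℝ,
      (0.99 : ℝ) ≤ μ.real {M | EmbedsColumnSpace p κ M A}

/-!
Write `m_i` for the `p`-th power of the `ℓ_p` norm of the `i`-th column of `M`, and call the column
heavy if `m_i > 2 κ^p`. All randomness used below is uniform on finite sets, so that averaging the
embedding guarantee yields a single matrix `M` which succeeds with probability `0.98` on two random
families of subspaces (`IsObliviousSubspaceEmbedding.exists_matrix`).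

The first family consists of `d` independent vectors with entries `± w_i^{1/p}`, where the weights
`w_i = Q / u_i`, with `u_i` uniform on `{1, …, Q}`, are heavy-tailed with mean about `log Q`. A
heavy column for which `w_i m_i` exceeds a multiple of `κ^p n log Q` forces `‖M y‖_p^p` above
`κ^p ‖y‖_p^p`, unless the other weights are unusually large or the signs cancel. As `y` is bad with
probability only `O(1/d)`, the second moment method (`sq_sum_tail_le`) bounds the expected number of
such columns by `1/d`. This expectation is at least of the order `∑ m_i / (κ^p n log Q)`, so the
heavy columns satisfy `∑ m_i = O(κ^p n log n / d)` once `Q` is of the order `n²`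
(`sum_heavy_colPow_le`).

The second family is spanned by a random sign vector `x`, for which `‖M x‖_p^p ≥ ‖x‖_p^p = n` must
hold. By the upper half of Khintchine's inequality, the heavy columns contribute at most `∑ m_i` to
the mean of `‖M x‖_p^p`, up to a constant, and the light ones at most `κ^p r^{1-p/2} n^{p/2}`, since
bounded entries make the `ℓ_2` norms of the rows small (`expect_powSum_mulVec_boolSign_le`). Hence
`1 ≤ O(κ^p) (log n / d + (r/n)^{1-p/2})`.

Finally, an embedding restricts to fewer coordinates. With at most `r d^k` of them, where
`k ≥ 2 / (2 - p)`, and `d ≤ r` by injectivity, `log n` becomes `O(log r)`, at the cost of an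
additional `1/d` (`exists_one_le_mul_log_sq_add`). The second bound is the first one in the regime
where both summands of the denominator are `O(d^{-1/p} log^{2/p} d)`.
-/

open Finset
open scoped BigOperators

/-! ### Powers and averages -/

/-- Jensen's inequality for the concave function `x ^ s` and the uniform distribution. -/
theorem expect_rpow_le {α : Type*} [Fintype α] [Nonempty α] {s : ℝ} (hs0 : 0 ≤ s) (hs1 : s ≤ 1)
    {f : α → ℝ} (hf : ∀ a, 0 ≤ f a) : 𝔼 a, f a ^ s ≤ (𝔼 a, f a) ^ s := by
  have hc : (0 : ℝ) < Fintype.card α := by exact_mod_cast Fintype.card_pos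
  have h := (Real.concaveOn_rpow hs0 hs1).le_map_sum (t := univ)
    (w := fun _ : α => (Fintype.card α : ℝ)⁻¹) (p := f) (fun _ _ => by positivity)
    (by simp [hc.ne']) (fun a _ => hf a)
  simp only [smul_eq_mul, ← mul_sum] at h
  rw [Fintype.expect_eq_sum_div_card, Fintype.expect_eq_sum_div_card, div_eq_inv_mul,
    div_eq_inv_mul]
  exact h

theorem rpow_sq_half (p x : ℝ) : (x ^ 2) ^ (p / 2) = |x| ^ p := by
  rw [← sq_abs, ← Real.rpow_natCast, ← Real.rpow_mul (abs_nonneg _)]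
  congr 1
  push_cast
  ring

/-- The power mean inequality for exponents in `[0, 1]`. -/
theorem sum_rpow_le_card_rpow_mul {r : ℕ} (hr : 0 < r) {s : ℝ} (hs0 : 0 ≤ s) (hs1 : s ≤ 1)
    {f : Fin r → ℝ} (hf : ∀ a, 0 ≤ f a) :
    ∑ a, f a ^ s ≤ (r : ℝ) ^ (1 - s) * (∑ a, f a) ^ s := by
  have : Nonempty (Fin r) := ⟨⟨0, hr⟩⟩
  have hc : (0 : ℝ) < r := by exact_mod_cast hr
  have h := expect_rpow_le hs0 hs1 hf
  rw [Fintype.expect_eq_sum_div_card, Fintype.expect_eq_sum_div_card,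
    Real.div_rpow (sum_nonneg fun a _ => hf a) (by positivity), Fintype.card_fin,
    div_le_iff₀ hc] at h
  rw [Real.rpow_sub hc, Real.rpow_one]
  calc _ ≤ _ := h
    _ = _ := by ring

theorem rpow_sum_le_sum_rpow {ι : Type*} (t : Finset ι) {s : ℝ} (hs0 : 0 < s) (hs1 : s ≤ 1)
    {f : ι → ℝ} (hf : ∀ a, 0 ≤ f a) : (∑ a ∈ t, f a) ^ s ≤ ∑ a ∈ t, f a ^ s := by
  classical
  induction t using Finset.induction_on with
  | empty => simp [Real.zero_rpow hs0.ne']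
  | insert a t ha ih =>
    rw [sum_insert ha, sum_insert ha]
    exact (Real.rpow_add_le_add_rpow (hf a) (sum_nonneg fun b _ => hf b) hs0.le hs1).trans
      (by gcongr)

theorem abs_add_rpow_le {p : ℝ} (hp1 : 1 ≤ p) (hp2 : p ≤ 2) (a b : ℝ) :
    |a + b| ^ p ≤ 2 * (|a| ^ p + |b| ^ p) := by
  have h := Real.rpow_sum_le_const_mul_sum_rpow (univ : Finset (Fin 2)) ![a, b] hp1
  simp only [Fin.sum_univ_two, card_univ, Fintype.card_fin, Matrix.cons_val_zero,
    Matrix.cons_val_one, Nat.cast_ofNat] at h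
  have h2 : (2 : ℝ) ^ (p - 1) ≤ 2 := by
    calc (2 : ℝ) ^ (p - 1) ≤ 2 ^ (1 : ℝ) :=
          Real.rpow_le_rpow_of_exponent_le (by norm_num) (by linarith)
      _ = 2 := Real.rpow_one 2
  calc |a + b| ^ p ≤ (|a| + |b|) ^ p :=
        Real.rpow_le_rpow (abs_nonneg _) (abs_add_le a b) (by linarith)
    _ ≤ 2 ^ (p - 1) * (|a| ^ p + |b| ^ p) := h
    _ ≤ 2 * (|a| ^ p + |b| ^ p) := by gcongr

/-- Under the uniform distribution on `ι → β`, a coordinate is independent of any function which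
ignores that coordinate. -/
theorem expect_coord_mul {ι β : Type*} [Fintype ι] [DecidableEq ι] [Fintype β] [Nonempty β]
    (i : ι) (f : β → ℝ) (h : (ι → β) → ℝ) (hh : ∀ u v, h (Function.update u i v) = h u) :
    𝔼 u, f (u i) * h u = (𝔼 v, f v) * 𝔼 u, h u := by
  let e := Equiv.funSplitAt i β
  obtain ⟨b₀⟩ := ‹Nonempty β›
  have key : ∀ b w, h (e.symm (b, w)) = h (e.symm (b₀, w)) := by
    intro b w
    rw [← hh (e.symm (b, w)) b₀]
    congr 1
    ext j
    by_cases hj : j = i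
    · subst hj; simp [e]
    · simp [e, hj]
  have e1 : 𝔼 u, f (u i) * h u = 𝔼 x : β × ({j // j ≠ i} → β), f x.1 * h (e.symm (b₀, x.2)) := by
    refine Fintype.expect_equiv e _ _ fun u => ?_
    rw [← key (e u).1 (e u).2]
    simp only [Prod.mk.eta, Equiv.symm_apply_apply]
    rfl
  have e2 : 𝔼 u, h u = 𝔼 x : β × ({j // j ≠ i} → β), h (e.symm (b₀, x.2)) := by
    refine Fintype.expect_equiv e _ _ fun u => ?_
    rw [← key (e u).1 (e u).2]
    simp
  rw [e1, e2, ← univ_product_univ, expect_product, expect_product]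
  dsimp only
  rw [Fintype.expect_const, expect_mul_expect]

theorem expect_coord {ι β : Type*} [Fintype ι] [DecidableEq ι] [Fintype β] [Nonempty β]
    (i : ι) (f : β → ℝ) : 𝔼 u : ι → β, f (u i) = 𝔼 v, f v := by
  simpa using expect_coord_mul i f (fun _ => 1) (fun _ _ => rfl)

/-- Cauchy–Schwarz for the average of `f` over an event. -/
theorem sq_expect_mul_indicator_le {α : Type*} [Fintype α] [Nonempty α] (f : α → ℝ) (P : α → Prop)
    [DecidablePred P] :
    (𝔼 a, f a * (if P a then 1 else 0)) ^ 2 ≤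
      (𝔼 a, f a ^ 2) * 𝔼 a, if P a then (1 : ℝ) else 0 := by
  have h := sum_mul_sq_le_sq_mul_sq univ f (fun a => if P a then (1 : ℝ) else 0)
  have h1 : ∀ a, (if P a then (1 : ℝ) else 0) ^ 2 = if P a then 1 else 0 := fun a => by
    split_ifs <;> norm_num
  simp only [h1] at h
  simp only [Fintype.expect_eq_sum_div_card]
  rw [div_pow, div_mul_div_comm, ← sq]
  gcongr

/-! ### Random signs -/

/-- The real number `1` or `-1` encoded by a Boolean. -/
def boolSign (b : Bool) : ℝ := if b then 1 else -1

theorem boolSign_sq (b : Bool) : boolSign b ^ 2 = 1 := by cases b <;> norm_num [boolSign]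

theorem abs_boolSign (b : Bool) : |boolSign b| = 1 := by cases b <;> norm_num [boolSign]

theorem boolSign_not (b : Bool) : boolSign (!b) = -boolSign b := by cases b <;> norm_num [boolSign]

theorem expect_boolSign : 𝔼 b, boolSign b = 0 := by
  rw [Fintype.expect_eq_sum_div_card]
  simp [boolSign]

theorem expect_boolSign_mul_boolSign {ι : Type*} [Fintype ι] [DecidableEq ι] (i j : ι) :
    𝔼 ε : ι → Bool, boolSign (ε i) * boolSign (ε j) = if i = j then 1 else 0 := by
  split_ifs with hij
  · subst hij
    simp [← sq, boolSign_sq]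
  · rw [expect_coord_mul i boolSign (fun ε => boolSign (ε j)), expect_boolSign, zero_mul]
    intro u v
    rw [Function.update_of_ne (Ne.symm hij)]

theorem expect_sum_boolSign_sq {ι : Type*} [Fintype ι] [DecidableEq ι] (t : Finset ι) (a : ι → ℝ) :
    𝔼 ε : ι → Bool, (∑ i ∈ t, a i * boolSign (ε i)) ^ 2 = ∑ i ∈ t, a i ^ 2 := by
  have h : ∀ ε : ι → Bool, (∑ i ∈ t, a i * boolSign (ε i)) ^ 2 =
      ∑ i ∈ t, ∑ j ∈ t, a i * a j * (boolSign (ε i) * boolSign (ε j)) := by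
    intro ε
    rw [sq, sum_mul_sum]
    refine sum_congr rfl fun i _ => sum_congr rfl fun j _ => by ring
  simp only [h, expect_sum_comm, ← mul_expect, expect_boolSign_mul_boolSign]
  refine sum_congr rfl fun i hi => ?_
  simp [hi, sq]

/-- The upper half of Khintchine's inequality, for exponents at most `2`. -/
theorem expect_abs_sum_boolSign_rpow_le {ι : Type*} [Fintype ι] [DecidableEq ι] {p : ℝ}
    (hp0 : 0 ≤ p) (hp2 : p ≤ 2) (t : Finset ι) (a : ι → ℝ) :
    𝔼 ε : ι → Bool, |∑ i ∈ t, a i * boolSign (ε i)| ^ p ≤ (∑ i ∈ t, a i ^ 2) ^ (p / 2) := by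
  rw [← expect_sum_boolSign_sq]
  refine le_trans (le_of_eq ?_) (expect_rpow_le (by linarith) (by linarith) fun ε => sq_nonneg _)
  exact expect_congr rfl fun ε _ => (rpow_sq_half p _).symm

/-! ### Column norms and random sign vectors -/

/-- The `p`-th power `∑ |v_i|^p` of the `ℓ_p` norm. -/
noncomputable def powSum (p : ℝ) {m : ℕ} (v : Fin m → ℝ) : ℝ := ∑ i, |v i| ^ p

/-- The `p`-th power of the `ℓ_p` norm of the `i`-th column of `M`. -/
noncomputable def colPow (p : ℝ) {r n : ℕ} (M : Matrix (Fin r) (Fin n) ℝ) (i : Fin n) : ℝ :=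
  ∑ j, |M j i| ^ p

theorem powSum_nonneg (p : ℝ) {m : ℕ} (v : Fin m → ℝ) : 0 ≤ powSum p v :=
  sum_nonneg fun _ _ => Real.rpow_nonneg (abs_nonneg _) _

/-- The contribution of the columns in `t` when all of them have `ℓ_p` norm at most `B^{1/p}`. -/
theorem sum_rpow_sum_sq_le_of_colPow_le {p : ℝ} (hp1 : 1 ≤ p) (hp2 : p ≤ 2) {r n : ℕ} (hr : 0 < r)
    (M : Matrix (Fin r) (Fin n) ℝ) {B : ℝ} (hB : 0 < B) (t : Finset (Fin n))
    (ht : ∀ i ∈ t, colPow p M i ≤ B) :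
    ∑ j, (∑ i ∈ t, M j i ^ 2) ^ (p / 2) ≤ B * (r : ℝ) ^ (1 - p / 2) * (n : ℝ) ^ (p / 2) := by
  have hp0 : 0 < p := by linarith
  -- An entry is at most `B^{1/p}`, so that its square is at most `B^{(2-p)/p}` times its `p`-th
  -- power.
  have hentry : ∀ j, ∀ i ∈ t, M j i ^ 2 ≤ B ^ ((2 - p) / p) * |M j i| ^ p := by
    intro j i hi
    have h1 : |M j i| ^ p ≤ B :=
      (single_le_sum (f := fun j => |M j i| ^ p)
        (fun _ _ => Real.rpow_nonneg (abs_nonneg _) _) (mem_univ j)).trans (ht i hi)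
    have h2 : |M j i| ^ (2 - p) ≤ B ^ ((2 - p) / p) := by
      calc |M j i| ^ (2 - p) = (|M j i| ^ p) ^ ((2 - p) / p) := by
            rw [← Real.rpow_mul (abs_nonneg _)]; congr 1; field_simp
        _ ≤ _ := Real.rpow_le_rpow (Real.rpow_nonneg (abs_nonneg _) _) h1
            (div_nonneg (by linarith) hp0.le)
    calc M j i ^ 2 = |M j i| ^ (2 - p) * |M j i| ^ p := by
          rw [← Real.rpow_add_of_nonneg (abs_nonneg _) (by linarith) hp0.le, ← sq_abs,
            ← Real.rpow_natCast]
          congr 1; push_cast; ring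
      _ ≤ _ := by gcongr
  have hS : ∀ j, 0 ≤ ∑ i ∈ t, |M j i| ^ p := fun j =>
    sum_nonneg fun _ _ => Real.rpow_nonneg (abs_nonneg _) _
  have htotal : ∑ j, ∑ i ∈ t, |M j i| ^ p ≤ B * n := by
    rw [sum_comm]
    calc ∑ i ∈ t, ∑ j, |M j i| ^ p ≤ ∑ i ∈ t, B := sum_le_sum ht
      _ = #t * B := by simp
      _ ≤ n * B := by
        gcongr
        simpa using card_le_univ t
      _ = B * n := mul_comm _ _
  calc ∑ j, (∑ i ∈ t, M j i ^ 2) ^ (p / 2)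
      ≤ ∑ j, (B ^ ((2 - p) / p) * ∑ i ∈ t, |M j i| ^ p) ^ (p / 2) := by
        refine sum_le_sum fun j _ => Real.rpow_le_rpow (sum_nonneg fun _ _ => sq_nonneg _) ?_
          (by linarith)
        rw [mul_sum]
        exact sum_le_sum (hentry j)
    _ = B ^ (1 - p / 2) * ∑ j, (∑ i ∈ t, |M j i| ^ p) ^ (p / 2) := by
        rw [mul_sum]
        refine sum_congr rfl fun j _ => ?_
        rw [Real.mul_rpow (by positivity) (hS j), ← Real.rpow_mul hB.le]
        congr 2
        field_simp
    _ ≤ B ^ (1 - p / 2) * ((r : ℝ) ^ (1 - p / 2) * (∑ j, ∑ i ∈ t, |M j i| ^ p) ^ (p / 2)) := by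
        gcongr
        exact sum_rpow_le_card_rpow_mul hr (by linarith) (by linarith) hS
    _ ≤ B ^ (1 - p / 2) * ((r : ℝ) ^ (1 - p / 2) * (B * n) ^ (p / 2)) := by
        gcongr
    _ = (B ^ (1 - p / 2) * B ^ (p / 2)) * (r : ℝ) ^ (1 - p / 2) * (n : ℝ) ^ (p / 2) := by
        rw [Real.mul_rpow hB.le (by positivity)]; ring
    _ = _ := by
        rw [← Real.rpow_add hB, sub_add_cancel, Real.rpow_one]

/-- The image of a random sign vector: heavy columns contribute their `ℓ_p` norms, while for the
light ones the `ℓ_2` norms of the rows are controlled by the bound on the columns. -/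
theorem expect_powSum_mulVec_boolSign_le {p : ℝ} (hp1 : 1 ≤ p) (hp2 : p ≤ 2) {r n : ℕ}
    (hr : 0 < r) (M : Matrix (Fin r) (Fin n) ℝ) {B : ℝ} (hB : 0 < B) :
    𝔼 ε : Fin n → Bool, powSum p (M.mulVec fun i => boolSign (ε i)) ≤
      2 * ((∑ i with B < colPow p M i, colPow p M i) +
        B * (r : ℝ) ^ (1 - p / 2) * (n : ℝ) ^ (p / 2)) := by
  set H : Finset (Fin n) := univ.filter fun i => B < colPow p M i with hH
  have hL : ∀ i ∈ Hᶜ, colPow p M i ≤ B := fun i hi => by simpa [hH] using hi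
  calc 𝔼 ε : Fin n → Bool, powSum p (M.mulVec fun i => boolSign (ε i))
      ≤ 𝔼 ε : Fin n → Bool, ∑ j, 2 * (|∑ i ∈ H, M j i * boolSign (ε i)| ^ p +
          |∑ i ∈ Hᶜ, M j i * boolSign (ε i)| ^ p) := by
        refine expect_le_expect fun ε _ => sum_le_sum fun j _ => ?_
        have : M.mulVec (fun i => boolSign (ε i)) j =
            ∑ i ∈ H, M j i * boolSign (ε i) + ∑ i ∈ Hᶜ, M j i * boolSign (ε i) := by
          rw [sum_add_sum_compl]; rfl
        rw [this]
        exact abs_add_rpow_le hp1 hp2 _ _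
    _ = ∑ j, 2 * ((𝔼 ε : Fin n → Bool, |∑ i ∈ H, M j i * boolSign (ε i)| ^ p) +
          𝔼 ε : Fin n → Bool, |∑ i ∈ Hᶜ, M j i * boolSign (ε i)| ^ p) := by
        simp only [expect_sum_comm, ← mul_expect, expect_add_distrib]
    _ ≤ ∑ j, 2 * ((∑ i ∈ H, M j i ^ 2) ^ (p / 2) + (∑ i ∈ Hᶜ, M j i ^ 2) ^ (p / 2)) := by
        gcongr <;> exact expect_abs_sum_boolSign_rpow_le (by linarith) hp2 _ _
    _ = 2 * (∑ j, (∑ i ∈ H, M j i ^ 2) ^ (p / 2) + ∑ j, (∑ i ∈ Hᶜ, M j i ^ 2) ^ (p / 2)) := by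
        rw [← mul_sum, sum_add_distrib]
    _ ≤ _ := by
        gcongr
        · simp only [colPow]
          rw [sum_comm]
          refine sum_le_sum fun j _ => ?_
          refine (rpow_sum_le_sum_rpow H (by linarith) (by linarith) fun i => sq_nonneg _).trans ?_
          simp only [rpow_sq_half, le_refl]
        · exact sum_rpow_sum_sq_le_of_colPow_le hp1 hp2 hr M hB _ hL

theorem half_abs_sub_rpow_le {p : ℝ} (hp1 : 1 ≤ p) (a b : ℝ) :
    (|a - b| / 2) ^ p ≤ (|a| ^ p + |b| ^ p) / 2 := by
  have h := (convexOn_rpow hp1).2 (Set.mem_Ici.2 (abs_nonneg a)) (Set.mem_Ici.2 (abs_nonneg b))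
    (show (0 : ℝ) ≤ 1 / 2 by norm_num) (show (0 : ℝ) ≤ 1 / 2 by norm_num) (by norm_num)
  simp only [smul_eq_mul] at h
  calc (|a - b| / 2) ^ p ≤ (1 / 2 * |a| + 1 / 2 * |b|) ^ p := by
        refine Real.rpow_le_rpow (by positivity) ?_ (by linarith)
        linarith [abs_sub a b]
    _ ≤ _ := by linarith

/-- With random signs, the image has at least the `ℓ_p` norm of the contribution of a given column
with probability at least one half: of two sign patterns which differ only in that column, one is
good, by convexity. -/
theorem half_le_expect_sign_good {p : ℝ} (hp1 : 1 ≤ p) {r n : ℕ} (M : Matrix (Fin r) (Fin n) ℝ)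
    (v : Fin n → ℝ) (i : Fin n) :
    1 / 2 ≤ 𝔼 ε : Fin n → Bool,
      if |v i| ^ p * colPow p M i ≤ powSum p (M.mulVec fun k => boolSign (ε k) * v k)
        then (1 : ℝ) else 0 := by
  set F : (Fin n → Bool) → ℝ := fun ε =>
    if |v i| ^ p * colPow p M i ≤ powSum p (M.mulVec fun k => boolSign (ε k) * v k)
        then (1 : ℝ) else 0 with hF
  let flip : (Fin n → Bool) → (Fin n → Bool) := fun ε => Function.update ε i (!ε i)
  have hflip : Function.Involutive flip := fun ε => by simp [flip]
  have hE : 𝔼 ε, F ε = 𝔼 ε, F (flip ε) :=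
    (Fintype.expect_equiv hflip.toPerm (fun ε => F (flip ε)) F fun ε => rfl).symm
  have hpt : ∀ ε, 1 ≤ F ε + F (flip ε) := by
    intro ε
    have hdiff : ∀ j, M.mulVec (fun k => boolSign (ε k) * v k) j -
        M.mulVec (fun k => boolSign (flip ε k) * v k) j = 2 * (boolSign (ε i) * (v i * M j i)) := by
      intro j
      simp only [Matrix.mulVec, dotProduct]
      rw [← sum_sub_distrib, sum_eq_single i]
      · simp only [flip, Function.update_self, boolSign_not]; ring
      · intro k _ hk
        simp [flip, Function.update_of_ne hk]
      · simp
    have hsum : |v i| ^ p * colPow p M i ≤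
        (powSum p (M.mulVec fun k => boolSign (ε k) * v k) +
          powSum p (M.mulVec fun k => boolSign (flip ε k) * v k)) / 2 := by
      simp only [colPow, powSum]
      rw [mul_sum, ← sum_add_distrib, sum_div]
      refine sum_le_sum fun j _ => ?_
      refine le_trans (le_of_eq ?_) (half_abs_sub_rpow_le hp1 _ _)
      rw [hdiff, abs_mul, abs_mul, abs_boolSign, abs_mul, ← Real.mul_rpow (abs_nonneg _)
        (abs_nonneg _)]
      congr 1
      norm_num
    simp only [hF]
    split_ifs <;> linarith
  have : 1 ≤ 𝔼 ε, (F ε + F (flip ε)) := by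
    calc (1 : ℝ) = 𝔼 _ε : Fin n → Bool, (1 : ℝ) := (Fintype.expect_const _).symm
      _ ≤ _ := expect_le_expect fun ε _ => hpt ε
  rw [expect_add_distrib, ← hE] at this
  linarith

/-! ### Heavy-tailed random vectors -/

/-- The weight `Q / u` for `u` in `{1, …, Q}`, where `u - 1` is the given element of `Fin Q`. For
uniform `u`, it exceeds `t` with probability about `1 / t`, as far as `t ≤ Q`. -/
noncomputable def heavyWeight {Q : ℕ} (v : Fin Q) : ℝ := Q / ((v : ℕ) + 1 : ℝ)

/-- The random vector with entries `± w^{1/p}`, for the given signs and heavy-tailed weights `w`. -/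
noncomputable def heavyVec (p : ℝ) {n Q : ℕ} (u : Fin n → Fin Q) (ε : Fin n → Bool) : Fin n → ℝ :=
  fun i => boolSign (ε i) * heavyWeight (u i) ^ (1 / p)

theorem heavyWeight_nonneg {Q : ℕ} (v : Fin Q) : 0 ≤ heavyWeight v := by
  unfold heavyWeight; positivity

theorem expect_heavyWeight {Q : ℕ} (hQ : 0 < Q) : 𝔼 v : Fin Q, heavyWeight v = harmonic Q := by
  have hQ' : (0 : ℝ) < Q := by exact_mod_cast hQ
  rw [Fintype.expect_eq_sum_div_card, Fintype.card_fin, harmonic,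
    ← Fin.sum_univ_eq_sum_range (fun i => ((i + 1 : ℕ) : ℚ)⁻¹)]
  push_cast
  rw [sum_div]
  refine sum_congr rfl fun v _ => ?_
  unfold heavyWeight
  field_simp

theorem abs_heavyWeight_rpow {p : ℝ} (hp : 0 < p) {Q : ℕ} (v : Fin Q) :
    |heavyWeight v ^ (1 / p)| ^ p = heavyWeight v := by
  rw [abs_of_nonneg (Real.rpow_nonneg (heavyWeight_nonneg v) _),
    ← Real.rpow_mul (heavyWeight_nonneg v), one_div_mul_cancel hp.ne', Real.rpow_one]

theorem powSum_heavyVec {p : ℝ} (hp : 0 < p) {n Q : ℕ} (u : Fin n → Fin Q) (ε : Fin n → Bool) :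
    powSum p (heavyVec p u ε) = ∑ i, heavyWeight (u i) := by
  refine sum_congr rfl fun i _ => ?_
  rw [heavyVec, abs_mul, abs_boolSign, one_mul, abs_heavyWeight_rpow hp]

/-- A column of mass `m` receives a weight at least `T / m` with probability at least `m / (2 T)`,
where the factor `2` accounts for the rounding of `Q m / T`. -/
theorem le_expect_heavyWeight_tail {Q : ℕ} (hQ : 0 < Q) {m T : ℝ} (hT : 0 < T) (hm : T ≤ Q * m) :
    min 1 (m / (2 * T)) ≤ 𝔼 v : Fin Q, if T ≤ heavyWeight v * m then (1 : ℝ) else 0 := by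
  have hQ' : (0 : ℝ) < Q := by exact_mod_cast hQ
  set x : ℝ := Q * m / T with hx
  have hx1 : 1 ≤ x := by rw [hx, le_div_iff₀ hT]; linarith
  have hfloor : x / 2 ≤ (⌊x⌋₊ : ℝ) := by
    have h1 : (1 : ℝ) ≤ ⌊x⌋₊ := by exact_mod_cast Nat.le_floor (by simpa using hx1)
    linarith [Nat.lt_floor_add_one x]
  have hsub : (univ.filter fun v : Fin Q => (v : ℕ) < ⌊x⌋₊) ⊆
      univ.filter fun v : Fin Q => T ≤ heavyWeight v * m := by
    intro v hv
    simp only [mem_filter, mem_univ, true_and] at hv ⊢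
    have h1 : ((v : ℕ) + 1 : ℝ) ≤ x :=
      le_trans (by exact_mod_cast hv) (Nat.floor_le (by linarith))
    rw [hx, le_div_iff₀ hT] at h1
    rw [heavyWeight, div_mul_eq_mul_div, le_div_iff₀ (by positivity)]
    linarith
  have hcard := card_le_card hsub
  rw [Fin.card_filter_val_lt] at hcard
  have hcard' : min (Q : ℝ) ⌊x⌋₊ ≤
      (#(univ.filter fun v : Fin Q => T ≤ heavyWeight v * m) : ℝ) := by
    exact_mod_cast hcard
  rw [Fintype.expect_eq_sum_div_card, Fintype.card_fin, sum_boole, le_div_iff₀ hQ']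
  refine le_trans ?_ hcard'
  rw [min_mul_of_nonneg _ _ hQ'.le, one_mul]
  refine min_le_min le_rfl (le_trans (le_of_eq ?_) hfloor)
  rw [hx]
  field_simp

/-- With probability at least `3/4`, the weights off a given coordinate add up to at most four times
their mean. -/
theorem le_expect_rest_small {n Q : ℕ} (hn : 0 < n) (hQ : 0 < Q) (i : Fin n) :
    3 / 4 ≤ 𝔼 u : Fin n → Fin Q,
      if ∑ k ∈ univ.erase i, heavyWeight (u k) ≤ 4 * n * (harmonic Q : ℝ) then (1 : ℝ) else 0 := by
  have : Nonempty (Fin Q) := ⟨⟨0, hQ⟩⟩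
  have hh : (0 : ℝ) < harmonic Q := by exact_mod_cast harmonic_pos hQ.ne'
  have hn' : (0 : ℝ) < n := by exact_mod_cast hn
  have hR : (0 : ℝ) < 4 * n * (harmonic Q : ℝ) := by positivity
  have hrest : 𝔼 u : Fin n → Fin Q, ∑ k ∈ univ.erase i, heavyWeight (u k) ≤
      n * (harmonic Q : ℝ) := by
    rw [expect_sum_comm]
    simp only [expect_coord, expect_heavyWeight hQ, sum_const, nsmul_eq_mul]
    gcongr
    exact_mod_cast (card_le_univ _).trans (by simp)
  have hpt : ∀ u : Fin n → Fin Q,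
      1 - (∑ k ∈ univ.erase i, heavyWeight (u k)) / (4 * n * (harmonic Q : ℝ)) ≤
      if ∑ k ∈ univ.erase i, heavyWeight (u k) ≤ 4 * n * (harmonic Q : ℝ) then (1 : ℝ) else 0 := by
    intro u
    have h0 : 0 ≤ ∑ k ∈ univ.erase i, heavyWeight (u k) :=
      sum_nonneg fun k _ => heavyWeight_nonneg _
    split_ifs with h
    · have := div_nonneg h0 hR.le
      linarith
    · have := (one_le_div hR).2 (not_le.1 h).le
      linarith
  refine le_trans ?_ (expect_le_expect fun u _ => hpt u)
  rw [expect_sub_distrib, Fintype.expect_const, ← expect_div]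
  have : (𝔼 u : Fin n → Fin Q, ∑ k ∈ univ.erase i, heavyWeight (u k)) /
      (4 * n * (harmonic Q : ℝ)) ≤ 1 / 4 := by
    rw [div_le_iff₀ hR]; linarith
  linarith

/-- If a heavy column receives a large weight while the other weights are of typical size and its
signs do not cancel, then the random vector is stretched by more than a factor `K`. -/
theorem mul_powSum_heavyVec_lt {p : ℝ} (hp : 0 < p) {r n Q : ℕ}
    (M : Matrix (Fin r) (Fin n) ℝ) {K R : ℝ} (hK : 0 < K) {i : Fin n}
    (hi : 2 * K < colPow p M i) {u : Fin n → Fin Q} {ε : Fin n → Bool} (hQ : 0 < Q)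
    (hlarge : 2 * K * R ≤ heavyWeight (u i) * colPow p M i)
    (hrest : ∑ k ∈ univ.erase i, heavyWeight (u k) ≤ R)
    (hsign : heavyWeight (u i) * colPow p M i ≤ powSum p (M.mulVec (heavyVec p u ε))) :
    K * powSum p (heavyVec p u ε) < powSum p (M.mulVec (heavyVec p u ε)) := by
  rw [powSum_heavyVec hp, ← add_sum_erase _ _ (mem_univ i)]
  have hw : 0 < heavyWeight (u i) := by unfold heavyWeight; positivity
  have h1 := mul_lt_mul_of_pos_left hi hw
  have h2 := mul_le_mul_of_nonneg_left hrest hK.le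
  nlinarith

/-- The second moment inequality for the number of heavy columns which receive a large weight; `σ`
is the expectation of this number. -/
theorem sq_sum_tail_le {p : ℝ} (hp1 : 1 ≤ p) {r n Q : ℕ} (hn : 0 < n) (hQ : 0 < Q)
    (M : Matrix (Fin r) (Fin n) ℝ) {K : ℝ} (hK : 0 < K) {T σ : ℝ}
    (hT : T = 2 * K * (4 * n * (harmonic Q : ℝ)))
    (hσ : σ = ∑ i with 2 * K < colPow p M i,
      𝔼 v : Fin Q, if T ≤ heavyWeight v * colPow p M i then (1 : ℝ) else 0) :
    (3 / 8 * σ) ^ 2 ≤ (σ + σ ^ 2) * 𝔼 a : (Fin n → Fin Q) × (Fin n → Bool),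
      if K * powSum p (heavyVec p a.1 a.2) < powSum p (M.mulVec (heavyVec p a.1 a.2))
        then (1 : ℝ) else 0 := by
  have hp0 : 0 < p := by linarith
  have : Nonempty (Fin Q) := ⟨⟨0, hQ⟩⟩
  set H : Finset (Fin n) := univ.filter fun i => 2 * K < colPow p M i with hH
  let E : Fin n → Fin Q → ℝ := fun i v => if T ≤ heavyWeight v * colPow p M i then 1 else 0
  have hE0 : ∀ i v, 0 ≤ E i v := fun i v => by simp only [E]; split_ifs <;> norm_num
  have hE1 : ∀ i v, E i v ^ 2 = E i v := fun i v => by simp only [E]; split_ifs <;> norm_num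
  let P : Fin n → ℝ := fun i => 𝔼 v, E i v
  have hP0 : ∀ i, 0 ≤ P i := fun i => expect_nonneg fun v _ => hE0 i v
  have hσ' : σ = ∑ i ∈ H, P i := hσ
  have hσ0 : 0 ≤ σ := hσ' ▸ sum_nonneg fun i _ => hP0 i
  let Z : (Fin n → Fin Q) × (Fin n → Bool) → ℝ := fun a => ∑ i ∈ H, E i (a.1 i)
  have hcs := sq_expect_mul_indicator_le Z fun a =>
    K * powSum p (heavyVec p a.1 a.2) < powSum p (M.mulVec (heavyVec p a.1 a.2))
  have hZ2 : 𝔼 a, Z a ^ 2 ≤ σ + σ ^ 2 := by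
    rw [← univ_product_univ, expect_product]
    simp only [Z, Fintype.expect_const]
    have h1 : ∀ u : Fin n → Fin Q, (∑ i ∈ H, E i (u i)) ^ 2 =
        ∑ i ∈ H, ∑ j ∈ H, E i (u i) * E j (u j) := fun u => by rw [sq, sum_mul_sum]
    have h2 : ∀ i j, 𝔼 u : Fin n → Fin Q, E i (u i) * E j (u j) ≤
        (if i = j then P i else 0) + P i * P j := by
      intro i j
      split_ifs with hij
      · subst hij
        simp only [← sq, hE1]
        rw [expect_coord]
        nlinarith [hP0 i]
      · rw [expect_coord_mul i (E i) (fun u => E j (u j)), expect_coord, zero_add]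
        intro u v
        rw [Function.update_of_ne (Ne.symm hij)]
    simp only [h1, expect_sum_comm]
    calc _ ≤ ∑ i ∈ H, ∑ j ∈ H, ((if i = j then P i else 0) + P i * P j) :=
          sum_le_sum fun i _ => sum_le_sum fun j _ => h2 i j
      _ = σ + σ ^ 2 := by
          simp only [sum_add_distrib, ← sum_mul_sum, ← hσ', ← sq]
          congr 1
          rw [hσ']
          refine sum_congr rfl fun i hi => ?_
          simp [hi]
  have hZ1 : 3 / 8 * σ ≤ 𝔼 a, Z a *
      (if K * powSum p (heavyVec p a.1 a.2) < powSum p (M.mulVec (heavyVec p a.1 a.2))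
        then (1 : ℝ) else 0) := by
    let R : Fin n → (Fin n → Fin Q) → ℝ := fun i u =>
      if ∑ k ∈ univ.erase i, heavyWeight (u k) ≤ 4 * n * (harmonic Q : ℝ) then 1 else 0
    let S : Fin n → (Fin n → Fin Q) → (Fin n → Bool) → ℝ := fun i u ε =>
      if heavyWeight (u i) * colPow p M i ≤ powSum p (M.mulVec (heavyVec p u ε)) then 1 else 0
    have hS : ∀ i u, 1 / 2 ≤ 𝔼 ε, S i u ε := by
      intro i u
      have := half_le_expect_sign_good hp1 M (fun k => heavyWeight (u k) ^ (1 / p)) i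
      simp only [abs_heavyWeight_rpow hp0] at this
      exact this
    have hone : ∀ i ∈ H, 3 / 8 * P i ≤
        𝔼 a : (Fin n → Fin Q) × (Fin n → Bool), E i (a.1 i) * R i a.1 * S i a.1 a.2 := by
      intro i _
      rw [← univ_product_univ, expect_product]
      simp only [← mul_expect]
      have hR0 : ∀ u, 0 ≤ R i u := fun u => by simp only [R]; split_ifs <;> norm_num
      calc 3 / 8 * P i = P i * (3 / 4) * (1 / 2) := by ring
        _ ≤ P i * (𝔼 u, R i u) * (1 / 2) := by
            have h34 : 3 / 4 ≤ 𝔼 u, R i u := le_expect_rest_small hn hQ i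
            have := hP0 i
            gcongr
        _ = 𝔼 u : Fin n → Fin Q, E i (u i) * R i u * (1 / 2) := by
            rw [← expect_mul, expect_coord_mul]
            intro u v
            have : ∑ k ∈ univ.erase i, heavyWeight (Function.update u i v k) =
                ∑ k ∈ univ.erase i, heavyWeight (u k) :=
              sum_congr rfl fun k hk => by rw [Function.update_of_ne (ne_of_mem_erase hk)]
            simp only [R, this]
        _ ≤ _ := expect_le_expect fun u _ =>
            mul_le_mul_of_nonneg_left (hS i u) (mul_nonneg (hE0 _ _) (hR0 u))
    calc 3 / 8 * σ = ∑ i ∈ H, 3 / 8 * P i := by rw [hσ', mul_sum]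
      _ ≤ ∑ i ∈ H, 𝔼 a : (Fin n → Fin Q) × (Fin n → Bool),
            E i (a.1 i) * R i a.1 * S i a.1 a.2 := sum_le_sum hone
      _ = 𝔼 a : (Fin n → Fin Q) × (Fin n → Bool),
            ∑ i ∈ H, E i (a.1 i) * R i a.1 * S i a.1 a.2 := by rw [expect_sum_comm]
      _ ≤ _ := by
          refine expect_le_expect fun a _ => ?_
          simp only [Z]
          rw [sum_mul]
          refine sum_le_sum fun i hi => ?_
          have hi' : 2 * K < colPow p M i := by simpa [hH] using hi
          simp only [E, R, S]
          split_ifs with h1 h2 h3 h4 <;> norm_num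
          exact h4 (mul_powSum_heavyVec_lt hp0 M hK hi' hQ (hT ▸ h1) h2 h3)
  calc (3 / 8 * σ) ^ 2 ≤ _ := by gcongr
    _ ≤ _ := hcs
    _ ≤ _ := by
        gcongr

/-! ### Extracting a matrix from an oblivious embedding -/

theorem vecLpNorm_eq_powSum {p : ℝ} (hp : 0 < p) {m : ℕ} (v : Fin m → ℝ) :
    vecLpNorm p v = powSum p v ^ (1 / p) := vecLpNorm_eq_sum hp v

theorem vecLpNorm_rpow {p : ℝ} (hp : 0 < p) {m : ℕ} (v : Fin m → ℝ) :
    vecLpNorm p v ^ p = powSum p v := by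
  rw [vecLpNorm_eq_powSum hp, ← Real.rpow_mul (powSum_nonneg p v), one_div_mul_cancel hp.ne',
    Real.rpow_one]

theorem vecLpNorm_nonneg {p : ℝ} (hp : 0 < p) {m : ℕ} (v : Fin m → ℝ) : 0 ≤ vecLpNorm p v := by
  rw [vecLpNorm_eq_powSum hp]
  exact Real.rpow_nonneg (powSum_nonneg p v) _

theorem continuous_vecLpNorm {p : ℝ} (hp : 0 < p) (m : ℕ) :
    Continuous fun v : Fin m → ℝ => vecLpNorm p v := by
  simp only [vecLpNorm_eq_sum hp]
  refine Continuous.rpow_const (continuous_finsetSum _ fun i _ => ?_)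
    fun _ => Or.inr (by positivity)
  exact (continuous_abs.comp (continuous_apply i)).rpow_const fun _ => Or.inr hp.le

theorem vecLpNorm_zero {p : ℝ} (hp : 0 < p) (m : ℕ) : vecLpNorm p (0 : Fin m → ℝ) = 0 := by
  rw [vecLpNorm_eq_sum hp]
  simp [Real.zero_rpow hp.ne', hp.ne']

theorem eq_zero_of_vecLpNorm_nonpos {p : ℝ} (hp : 0 < p) {m : ℕ} {v : Fin m → ℝ}
    (h : vecLpNorm p v ≤ 0) : v = 0 := by
  have h0 : powSum p v = 0 := by
    rw [← vecLpNorm_rpow hp, le_antisymm h (vecLpNorm_nonneg hp v), Real.zero_rpow hp.ne']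
  ext i
  have := (sum_eq_zero_iff_of_nonneg fun i _ => Real.rpow_nonneg (abs_nonneg (v i)) p).1 h0 i
    (mem_univ i)
  simpa using (Real.rpow_eq_zero (abs_nonneg _) hp.ne').1 this

theorem measurableSet_embedsColumnSpace {p : ℝ} (hp : 0 < p) (κ : ℝ) {r n d : ℕ}
    (A : Matrix (Fin n) (Fin d) ℝ) :
    MeasurableSet {M : Matrix (Fin r) (Fin n) ℝ | EmbedsColumnSpace p κ M A} := by
  have : BorelSpace (Matrix (Fin r) (Fin n) ℝ) :=
    inferInstanceAs (BorelSpace (Fin r → Fin n → ℝ))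
  refine IsClosed.measurableSet ?_
  simp only [EmbedsColumnSpace, Set.ofPred_forall, Set.ofPred_and]
  refine isClosed_iInter fun x => ?_
  have hc : Continuous fun M : Matrix (Fin r) (Fin n) ℝ =>
      vecLpNorm p (M.mulVec (A.mulVec x)) :=
    (continuous_vecLpNorm hp r).comp (continuous_id.matrix_mulVec continuous_const)
  exact (isClosed_le continuous_const hc).inter (isClosed_le hc continuous_const)

open Classical in
/-- Averaging over the embedding: some matrix in its support succeeds with high probability on each
of two random families of subspaces. -/
theorem IsObliviousSubspaceEmbedding.exists_matrix {p κ : ℝ} (hp : 0 < p) {r n d : ℕ}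
    {μ : MeasureTheory.Measure (Matrix (Fin r) (Fin n) ℝ)}
    (h : IsObliviousSubspaceEmbedding p κ r n d μ) {α β : Type} [Fintype α] [Nonempty α]
    [Fintype β] [Nonempty β] (f : α → Matrix (Fin n) (Fin d) ℝ)
    (g : β → Matrix (Fin n) (Fin d) ℝ) :
    ∃ M : Matrix (Fin r) (Fin n) ℝ,
      0.98 ≤ (𝔼 a, if EmbedsColumnSpace p κ M (f a) then (1 : ℝ) else 0) ∧
      0.98 ≤ 𝔼 b, if EmbedsColumnSpace p κ M (g b) then (1 : ℝ) else 0 := by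
  obtain ⟨hμ, h⟩ := h
  have hint : ∀ A : Matrix (Fin n) (Fin d) ℝ, MeasureTheory.Integrable
      (fun M => if EmbedsColumnSpace p κ M A then (1 : ℝ) else 0) μ := fun A =>
    (MeasureTheory.integrable_const (1 : ℝ)).indicator (measurableSet_embedsColumnSpace hp κ A)
  have hval : ∀ A : Matrix (Fin n) (Fin d) ℝ,
      0.99 ≤ ∫ M, (if EmbedsColumnSpace p κ M A then (1 : ℝ) else 0) ∂μ := fun A => by
    refine (h A).trans (le_of_eq ?_)
    exact (MeasureTheory.integral_indicator_one (measurableSet_embedsColumnSpace hp κ A)).symm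
  have key : ∀ {γ : Type} [Fintype γ] [Nonempty γ] (f : γ → Matrix (Fin n) (Fin d) ℝ),
      MeasureTheory.Integrable
        (fun M => 𝔼 a, if EmbedsColumnSpace p κ M (f a) then (1 : ℝ) else 0) μ ∧
      0.99 ≤ ∫ M, (𝔼 a, if EmbedsColumnSpace p κ M (f a) then (1 : ℝ) else 0) ∂μ := by
    intro γ _ _ f
    have hc : (0 : ℝ) < Fintype.card γ := by exact_mod_cast Fintype.card_pos
    simp only [Fintype.expect_eq_sum_div_card]
    refine ⟨(MeasureTheory.integrable_finsetSum _ fun a _ => hint (f a)).div_const _, ?_⟩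
    rw [MeasureTheory.integral_div, MeasureTheory.integral_finsetSum _ fun a _ => hint (f a),
      le_div_iff₀ hc]
    calc (0.99 : ℝ) * Fintype.card γ = ∑ _a : γ, (0.99 : ℝ) := by simp [mul_comm]
      _ ≤ _ := sum_le_sum fun a _ => hval (f a)
  have hle : ∀ {γ : Type} [Fintype γ] [Nonempty γ] (f : γ → Matrix (Fin n) (Fin d) ℝ)
      (M : Matrix (Fin r) (Fin n) ℝ),
      (𝔼 a, if EmbedsColumnSpace p κ M (f a) then (1 : ℝ) else 0) ≤ 1 := by
    intro γ _ _ f M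
    calc _ ≤ 𝔼 _a : γ, (1 : ℝ) := expect_le_expect fun a _ => by split_ifs <;> norm_num
      _ = 1 := Fintype.expect_const _
  obtain ⟨M, hM⟩ := MeasureTheory.exists_integral_le ((key f).1.add (key g).1)
  rw [MeasureTheory.integral_add' (key f).1 (key g).1] at hM
  have h1 := (key f).2
  have h2 := (key g).2
  have h3 := hle f M
  have h4 := hle g M
  simp only [Pi.add_apply] at hM
  exact ⟨M, by linarith, by linarith⟩

theorem EmbedsColumnSpace.powSum_le {p κ : ℝ} (hp : 0 < p) (hκ : 0 ≤ κ) {r n d : ℕ}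
    {M : Matrix (Fin r) (Fin n) ℝ} {A : Matrix (Fin n) (Fin d) ℝ}
    (h : EmbedsColumnSpace p κ M A) (c : Fin d) :
    powSum p (A.col c) ≤ powSum p (M.mulVec (A.col c)) ∧
      powSum p (M.mulVec (A.col c)) ≤ κ ^ p * powSum p (A.col c) := by
  have hc := h (Pi.single c 1)
  rw [Matrix.mulVec_single_one] at hc
  constructor
  · rw [← vecLpNorm_rpow hp, ← vecLpNorm_rpow hp]
    exact Real.rpow_le_rpow (vecLpNorm_nonneg hp _) hc.1 hp.le
  · rw [← vecLpNorm_rpow hp, ← vecLpNorm_rpow hp, ← Real.mul_rpow hκ (vecLpNorm_nonneg hp _)]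
    exact Real.rpow_le_rpow (vecLpNorm_nonneg hp _) hc.2 hp.le

/-- An embedding for `ℝ^{m + k}` restricts to the first `m` coordinates. -/
theorem IsObliviousSubspaceEmbedding.restrict {p κ : ℝ} (hp : 0 < p) {r m k d : ℕ}
    {μ : MeasureTheory.Measure (Matrix (Fin r) (Fin (m + k)) ℝ)}
    (h : IsObliviousSubspaceEmbedding p κ r (m + k) d μ) :
    IsObliviousSubspaceEmbedding p κ r m d
      (μ.map fun M => M.submatrix id (Fin.castAdd k)) := by
  obtain ⟨hμ, h⟩ := h
  have hmeas : Measurable fun M : Matrix (Fin r) (Fin (m + k)) ℝ =>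
      M.submatrix id (Fin.castAdd k) :=
    measurable_pi_lambda _ fun i => measurable_pi_lambda _ fun j =>
      (measurable_pi_apply (Fin.castAdd k j)).comp (measurable_pi_apply i)
  refine ⟨MeasureTheory.Measure.isProbabilityMeasure_map hmeas.aemeasurable, fun A => ?_⟩
  let A' : Matrix (Fin (m + k)) (Fin d) ℝ :=
    Matrix.of (Fin.append (fun i => A i) (fun _ => 0))
  have hl : ∀ x i, A'.mulVec x (Fin.castAdd k i) = A.mulVec x i := by
    intro x i; simp [A', Matrix.mulVec, dotProduct]
  have hr : ∀ x i, A'.mulVec x (Fin.natAdd m i) = 0 := by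
    intro x i; simp [A', Matrix.mulVec, dotProduct]
  rw [MeasureTheory.map_measureReal_apply hmeas (measurableSet_embedsColumnSpace hp κ A)]
  refine (h A').trans (MeasureTheory.measureReal_mono fun M hM x => ?_)
  have hM' := hM x
  have h1 : vecLpNorm p (A'.mulVec x) = vecLpNorm p (A.mulVec x) := by
    rw [vecLpNorm_eq_sum hp, vecLpNorm_eq_sum hp, Fin.sum_univ_add]
    simp only [hl, hr, abs_zero, Real.zero_rpow hp.ne', sum_const_zero, add_zero]
  have h2 : M.mulVec (A'.mulVec x) =
      (M.submatrix id (Fin.castAdd k)).mulVec (A.mulVec x) := by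
    ext j
    simp only [Matrix.mulVec, dotProduct] at hl hr ⊢
    rw [Fin.sum_univ_add]
    simp only [hl, hr, mul_zero, sum_const_zero, add_zero, Matrix.submatrix_apply, id]
  rw [h1, h2] at hM'
  exact hM'

theorem IsObliviousSubspaceEmbedding.exists_embeds {p κ : ℝ} {r n d : ℕ}
    {μ : MeasureTheory.Measure (Matrix (Fin r) (Fin n) ℝ)}
    (h : IsObliviousSubspaceEmbedding p κ r n d μ) (A : Matrix (Fin n) (Fin d) ℝ) :
    ∃ M : Matrix (Fin r) (Fin n) ℝ, EmbedsColumnSpace p κ M A := by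
  by_contra hne
  push Not at hne
  have := h.2 A
  simp only [hne, Set.ofPred_false, MeasureTheory.measureReal_empty] at this
  norm_num at this

theorem IsObliviousSubspaceEmbedding.one_le_distortion {p κ : ℝ} (hp : 0 < p) {r n d : ℕ}
    (hn : 0 < n) (hd : 0 < d) {μ : MeasureTheory.Measure (Matrix (Fin r) (Fin n) ℝ)}
    (h : IsObliviousSubspaceEmbedding p κ r n d μ) : 1 ≤ κ := by
  obtain ⟨M, hM⟩ := h.exists_embeds (Matrix.of fun _ _ => 1)
  have h1 := hM (Pi.single ⟨0, hd⟩ 1)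
  rw [Matrix.mulVec_single_one] at h1
  have h2 : 0 < vecLpNorm p ((Matrix.of fun _ _ => 1 : Matrix (Fin n) (Fin d) ℝ).col ⟨0, hd⟩) := by
    by_contra hcon
    have := congrFun (eq_zero_of_vecLpNorm_nonpos hp (not_lt.1 hcon)) ⟨0, hn⟩
    simp at this
  exact le_of_mul_le_mul_right (by linarith [h1.1.trans h1.2]) h2

/-- An embedding into fewer than `n` dimensions is injective on `d`-dimensional subspaces, so that
it has at least `d` rows. -/
theorem IsObliviousSubspaceEmbedding.dim_le_rows {p κ : ℝ} (hp : 0 < p) {r n d : ℕ}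
    (hrn : r < n) {μ : MeasureTheory.Measure (Matrix (Fin r) (Fin n) ℝ)}
    (h : IsObliviousSubspaceEmbedding p κ r n d μ) : d ≤ r := by
  by_contra! hd
  obtain ⟨k, rfl⟩ := Nat.exists_eq_add_of_le (Nat.succ_le_of_lt hrn)
  obtain ⟨M, hM⟩ := (h.restrict hp).exists_embeds
    (fun i j => if (i : ℕ) = j then 1 else 0)
  have hker : LinearMap.ker M.mulVecLin ≠ ⊥ :=
    LinearMap.ker_ne_bot_of_finrank_lt (by simp)
  obtain ⟨y, hy, hy0⟩ := Submodule.exists_mem_ne_zero_of_ne_bot hker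
  rw [LinearMap.mem_ker, Matrix.mulVecLin_apply] at hy
  have hx := (hM fun j => if hj : (j : ℕ) < r + 1 then y ⟨j, hj⟩ else 0).1
  have hA : Matrix.mulVec (fun i j => if (i : ℕ) = j then 1 else 0 :
      Matrix (Fin (r + 1)) (Fin d) ℝ)
      (fun j => if hj : (j : ℕ) < r + 1 then y ⟨j, hj⟩ else 0) = y := by
    ext i
    simp only [Matrix.mulVec, dotProduct]
    rw [sum_eq_single ⟨i, lt_of_lt_of_le i.2 hd⟩]
    · simp [Nat.lt_succ_iff.1 i.2]
    · intro j _ hj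
      have : (i : ℕ) ≠ j := fun hij => hj (Fin.ext hij.symm)
      simp [this]
    · simp
  rw [hA, hy, vecLpNorm_zero hp] at hx
  exact hy0 (eq_zero_of_vecLpNorm_nonpos hp hx)

/-! ### The distortion bound for a fixed dimension -/

/-- The heavy columns carry little mass if the heavy-tailed random vector is stretched by more than
a factor `K` with probability at most `1 / (49 d)`. -/
theorem sum_heavy_colPow_le {p : ℝ} (hp1 : 1 ≤ p) {r n Q d : ℕ} (hn : 0 < n) (hQ : 0 < Q)
    (hd : 0 < d) (M : Matrix (Fin r) (Fin n) ℝ) {K : ℝ} (hK : 0 < K)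
    (hnQ : 4 * n * (harmonic Q : ℝ) ≤ Q)
    (hq : d * (𝔼 a : (Fin n → Fin Q) × (Fin n → Bool),
      if K * powSum p (heavyVec p a.1 a.2) < powSum p (M.mulVec (heavyVec p a.1 a.2))
        then (1 : ℝ) else 0) ≤ 1 / 49) :
    ∑ i with 2 * K < colPow p M i, colPow p M i ≤ 16 * K * n * (harmonic Q : ℝ) / d := by
  have hh : (0 : ℝ) < harmonic Q := by exact_mod_cast harmonic_pos hQ.ne'
  have hn' : (0 : ℝ) < n := by exact_mod_cast hn
  have hd' : (1 : ℝ) ≤ d := by exact_mod_cast hd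
  obtain ⟨T, hT⟩ : ∃ T : ℝ, T = 2 * K * (4 * n * (harmonic Q : ℝ)) := ⟨_, rfl⟩
  have hT0 : 0 < T := by rw [hT]; positivity
  obtain ⟨σ, hσ⟩ : ∃ σ : ℝ, σ = ∑ i with 2 * K < colPow p M i,
      𝔼 v : Fin Q, if T ≤ heavyWeight v * colPow p M i then (1 : ℝ) else 0 := ⟨_, rfl⟩
  have hP0 : ∀ i, 0 ≤ 𝔼 v : Fin Q, if T ≤ heavyWeight v * colPow p M i then (1 : ℝ) else 0 :=
    fun i => expect_nonneg fun v _ => by split_ifs <;> norm_num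
  have hσ0 : 0 ≤ σ := hσ ▸ sum_nonneg fun i _ => hP0 i
  have hmom := sq_sum_tail_le hp1 hn hQ M hK hT hσ
  set q := 𝔼 a : (Fin n → Fin Q) × (Fin n → Bool),
      if K * powSum p (heavyVec p a.1 a.2) < powSum p (M.mulVec (heavyVec p a.1 a.2))
        then (1 : ℝ) else 0
  have hq0 : 0 ≤ q := expect_nonneg fun a _ => by split_ifs <;> norm_num
  have hq1 : q ≤ 1 / 49 := by nlinarith
  have hσq : σ ≤ 9 * q := by
    rcases hσ0.eq_or_lt with h | h
    · linarith
    · have : σ * (9 / 64 * σ) ≤ σ * ((1 + σ) * q) := by nlinarith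
      have := le_of_mul_le_mul_left this h
      nlinarith
  have hσ1 : σ < 1 := by linarith
  have hone : ∀ i ∈ univ.filter (fun i => 2 * K < colPow p M i), colPow p M i / (2 * T) ≤
      𝔼 v : Fin Q, if T ≤ heavyWeight v * colPow p M i then (1 : ℝ) else 0 := by
    intro i hi
    have hi' : 2 * K < colPow p M i := by simpa using hi
    have hTm : T ≤ Q * colPow p M i := by
      rw [hT]
      calc 2 * K * (4 * n * (harmonic Q : ℝ)) ≤ 2 * K * Q := by gcongr
        _ ≤ colPow p M i * Q := by gcongr
        _ = _ := mul_comm _ _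
    have hmin := le_expect_heavyWeight_tail hQ hT0 hTm
    have hle : (𝔼 v : Fin Q, if T ≤ heavyWeight v * colPow p M i then (1 : ℝ) else 0) ≤ σ := by
      rw [hσ]
      exact single_le_sum (f := fun i => 𝔼 v : Fin Q,
        if T ≤ heavyWeight v * colPow p M i then (1 : ℝ) else 0) (fun i _ => hP0 i) hi
    rcases min_le_iff.1 hmin with h | h
    · linarith
    · exact h
  have hsum : (∑ i with 2 * K < colPow p M i, colPow p M i) / (2 * T) ≤ σ := by
    rw [sum_div, hσ]
    exact sum_le_sum hone
  rw [div_le_iff₀ (by positivity)] at hsum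
  rw [le_div_iff₀ (by linarith)]
  have h1 : σ * d ≤ 1 := by nlinarith
  calc _ ≤ σ * (2 * T) * d := by gcongr
    _ = (σ * d) * (2 * T) := by ring
    _ ≤ 1 * (2 * T) := by gcongr
    _ = _ := by rw [hT]; ring

open Classical in
/-- If `d` independent samples all avoid an event with probability at least `0.98`, the event has
probability at most `1 / (49 d)`. -/
theorem mul_expect_le_of_expect_forall {α : Type*} [Fintype α] [Nonempty α] (d : ℕ)
    (bad : α → Prop)
    (h : 0.98 ≤ 𝔼 A : Fin d → α, if ∀ c, ¬ bad (A c) then (1 : ℝ) else 0) :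
    d * (𝔼 a, if bad a then (1 : ℝ) else 0) ≤ 1 / 49 := by
  set q := 𝔼 a, if bad a then (1 : ℝ) else 0 with hqdef
  have hq0 : 0 ≤ q := expect_nonneg fun a _ => by split_ifs <;> norm_num
  have hq1 : q ≤ 1 := by
    calc q ≤ 𝔼 _a : α, (1 : ℝ) := expect_le_expect fun a _ => by split_ifs <;> norm_num
      _ = 1 := Fintype.expect_const _
  have hpow : (𝔼 A : Fin d → α, if ∀ c, ¬ bad (A c) then (1 : ℝ) else 0) = (1 - q) ^ d := by
    have h1 : 1 - q = 𝔼 a, if bad a then (0 : ℝ) else 1 := by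
      rw [hqdef, ← Fintype.expect_const (ι := α) (1 : ℝ), ← expect_sub_distrib]
      exact expect_congr rfl fun a _ => by split_ifs <;> norm_num
    rw [h1, expect_pow, Fintype.piFinset_univ]
    refine expect_congr rfl fun A _ => ?_
    by_cases hA : ∀ c, ¬ bad (A c)
    · rw [if_pos hA]
      exact (prod_eq_one fun c _ => if_neg (hA c)).symm
    · rw [if_neg hA]
      push Not at hA
      obtain ⟨c, hc⟩ := hA
      exact (prod_eq_zero (i := c) (mem_univ c) (by simp [hc])).symm
  rw [hpow] at h
  have h2 : 1 + d * q ≤ (1 + q) ^ d := one_add_mul_le_pow (by linarith) d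
  have h3 : (1 - q) ^ d * (1 + q) ^ d ≤ 1 := by
    rw [← mul_pow]
    exact pow_le_one₀ (by nlinarith) (by nlinarith)
  have h4 : 0 ≤ d * q := by positivity
  nlinarith

/-- The heavy columns of a matrix drawn from the embedding have total mass `O(κ^p n log n / d)`, by
the heavy-tailed vectors, and a random sign vector `x` must satisfy `‖M x‖_p^p ≥ n`. -/
theorem IsObliviousSubspaceEmbedding.one_le_mul_log_add {p κ : ℝ} (hp1 : 1 ≤ p) (hp2 : p ≤ 2)
    {r n d : ℕ} (hn : 0 < n) (hd : 0 < d) (hr : 0 < r)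
    {μ : MeasureTheory.Measure (Matrix (Fin r) (Fin n) ℝ)}
    (h : IsObliviousSubspaceEmbedding p κ r n d μ) :
    1 ≤ 100 * κ ^ p * (Real.log (8 * n) / d + ((r : ℝ) / n) ^ (1 - p / 2)) := by
  classical
  have hp0 : 0 < p := by linarith
  have hκ : 0 < κ := by linarith [h.one_le_distortion hp0 hn hd]
  have hn1 : (1 : ℝ) ≤ n := by exact_mod_cast hn
  have hn' : (0 : ℝ) < n := by linarith
  have hd' : (0 : ℝ) < d := by exact_mod_cast hd
  have hr' : (0 : ℝ) < r := by exact_mod_cast hr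
  obtain ⟨K, hKdef⟩ : ∃ K, K = κ ^ p := ⟨_, rfl⟩
  have hK : 0 < K := by rw [hKdef]; positivity
  -- The range of the weights has to exceed `4 n` times their mean, which is about `log Q`.
  obtain ⟨Q, hQdef⟩ : ∃ Q : ℕ, Q = (8 * n) ^ 2 := ⟨_, rfl⟩
  have hQ : 0 < Q := by rw [hQdef]; positivity
  have : Nonempty (Fin Q) := ⟨⟨0, hQ⟩⟩
  have hharm : (harmonic Q : ℝ) ≤ 1 + 2 * Real.log (8 * n) := by
    refine (harmonic_le_one_add_log Q).trans (le_of_eq ?_)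
    rw [hQdef]
    push_cast
    rw [Real.log_pow]
    norm_num
  -- The factor `8` makes the logarithm exceed `1`.
  have hlog1 : 1 ≤ Real.log (8 * n) := by
    rw [Real.le_log_iff_exp_le (by positivity)]
    linarith [Real.exp_one_lt_d9]
  have hnQ : 4 * n * (harmonic Q : ℝ) ≤ Q := by
    have h1 : Real.log (8 * n) ≤ 8 * n - 1 := Real.log_le_sub_one_of_pos (by positivity)
    have h2 : (harmonic Q : ℝ) ≤ 16 * n := by linarith
    calc 4 * n * (harmonic Q : ℝ) ≤ 4 * n * (16 * n) := by gcongr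
      _ = Q := by rw [hQdef]; push_cast; ring
  obtain ⟨M, hM1, hM2⟩ := h.exists_matrix hp0
    (fun A : Fin d → (Fin n → Fin Q) × (Fin n → Bool) =>
      Matrix.of fun i c => heavyVec p (A c).1 (A c).2 i)
    (fun ε : Fin n → Bool => Matrix.of fun i _ => boolSign (ε i))
  have hheavy : ∑ i with 2 * K < colPow p M i, colPow p M i ≤
      16 * K * n * (harmonic Q : ℝ) / d := by
    refine sum_heavy_colPow_le hp1 hn hQ hd M hK hnQ ?_
    have := mul_expect_le_of_expect_forall d
      (fun a : (Fin n → Fin Q) × (Fin n → Bool) =>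
        K * powSum p (heavyVec p a.1 a.2) < powSum p (M.mulVec (heavyVec p a.1 a.2)))
      (hM1.trans (expect_le_expect fun A _ => ?_))
    · exact this
    · split_ifs with h1 h2 <;> norm_num
      exact h2 fun c => not_lt.2 (hKdef ▸ (h1.powSum_le hp0 hκ.le c).2)
  have hsign := expect_powSum_mulVec_boolSign_le hp1 hp2 hr M (B := 2 * K) (by positivity)
  have hlow : 0.98 * (n : ℝ) ≤
      𝔼 ε : Fin n → Bool, powSum p (M.mulVec fun i => boolSign (ε i)) := by
    refine (mul_le_mul_of_nonneg_right hM2 hn'.le).trans ?_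
    rw [expect_mul]
    refine expect_le_expect fun ε _ => ?_
    split_ifs with h1
    · have h2 := (h1.powSum_le hp0 hκ.le ⟨0, hd⟩).1
      have h3 : powSum p (fun i => boolSign (ε i)) = n := by simp [powSum, abs_boolSign]
      rw [one_mul, ← h3]
      exact h2
    · rw [zero_mul]
      exact powSum_nonneg _ _
  have hpow : (r : ℝ) ^ (1 - p / 2) * (n : ℝ) ^ (p / 2) = n * ((r : ℝ) / n) ^ (1 - p / 2) := by
    rw [Real.div_rpow hr'.le hn'.le, Real.rpow_sub hn', Real.rpow_one]
    field_simp
  rw [← hKdef]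
  have hX : (0 : ℝ) ≤ ((r : ℝ) / n) ^ (1 - p / 2) := by positivity
  have hheavy' : 16 * K * n * (harmonic Q : ℝ) / d ≤ n * (48 * K * (Real.log (8 * n) / d)) := by
    rw [div_le_iff₀ hd']
    have : (n : ℝ) * (48 * K * (Real.log (8 * n) / d)) * d = 48 * K * n * Real.log (8 * n) := by
      field_simp
    rw [this]
    have h3 : (harmonic Q : ℝ) ≤ 3 * Real.log (8 * n) := by linarith
    calc 16 * K * n * (harmonic Q : ℝ) ≤ 16 * K * n * (3 * Real.log (8 * n)) := by gcongr
      _ = _ := by ring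
  have hfin : (n : ℝ) * 0.98 ≤ n * (96 * K * (Real.log (8 * n) / d) +
      4 * K * ((r : ℝ) / n) ^ (1 - p / 2)) := by
    have h5 : 2 * K * (r : ℝ) ^ (1 - p / 2) * (n : ℝ) ^ (p / 2) =
        2 * K * (n * ((r : ℝ) / n) ^ (1 - p / 2)) := by rw [← hpow]; ring
    rw [h5] at hsign
    linarith
  have hfin' := le_of_mul_le_mul_left hfin hn'
  have hY : 0 ≤ Real.log (8 * n) / d := by positivity
  nlinarith [mul_nonneg hK.le hX, mul_nonneg hK.le hY]

/-! ### Removing the dependence on the ambient dimension -/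

/-- Restricting to at most `r d^k` coordinates, where `k ≥ 2 / (2 - p)`, makes the logarithm of the
ambient dimension comparable to `log r`. -/
theorem exists_one_le_mul_log_sq_add {p : ℝ} (hp1 : 1 ≤ p) (hp2 : p < 2) :
    ∃ C : ℝ, 1 ≤ C ∧ ∀ (n d r : ℕ), 0 < n → 0 < d → ¬ (r = 1 ∧ d = 1) → r < n →
      ∀ (κ : ℝ) (μ : MeasureTheory.Measure (Matrix (Fin r) (Fin n) ℝ)),
        IsObliviousSubspaceEmbedding p κ r n d μ →
        1 ≤ C * κ ^ p * (Real.log r ^ 2 / d + ((r : ℝ) / n) ^ (1 - p / 2)) := by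
  have hp0 : 0 < p := by linarith
  obtain ⟨k, hk⟩ := exists_nat_ge (2 / (2 - p))
  refine ⟨100 * (2 * (k + 4) + 4), by have : (0 : ℝ) ≤ k := k.cast_nonneg; linarith, ?_⟩
  intro n d r hn hd hrd hrn κ μ h
  have hdr : d ≤ r := h.dim_le_rows hp0 hrn
  have hr2 : 2 ≤ r := by omega
  have hκ : 0 < κ := by linarith [h.one_le_distortion hp0 hn hd]
  have hr' : (2 : ℝ) ≤ r := by exact_mod_cast hr2
  have hd' : (1 : ℝ) ≤ d := by exact_mod_cast hd
  have hn' : (0 : ℝ) < n := by exact_mod_cast hn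
  have hs : 0 < 1 - p / 2 := by linarith
  obtain ⟨m, hm⟩ : ∃ m : ℕ, m = min n (r * d ^ k) := ⟨_, rfl⟩
  have hm0 : 0 < m := by
    rw [hm]; exact lt_min hn (by positivity)
  obtain ⟨l, rfl⟩ := Nat.exists_eq_add_of_le (show m ≤ n by rw [hm]; exact min_le_left _ _)
  have hmain := (h.restrict hp0).one_le_mul_log_add hp1 hp2.le hm0 hd (by omega)
  have hlog2 : 1 / 2 ≤ Real.log r := by
    have := Real.log_le_log (by norm_num) hr'
    linarith [Real.log_two_gt_d9]
  have hlog : Real.log (8 * m) ≤ (k + 4) * Real.log r := by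
    have h1 : m ≤ r ^ (k + 1) := by
      calc m ≤ r * d ^ k := by rw [hm]; exact min_le_right _ _
        _ ≤ r * r ^ k := by gcongr
        _ = r ^ (k + 1) := by ring
    have h2 : 8 * m ≤ r ^ (k + 4) := by
      calc 8 * m ≤ r ^ 3 * r ^ (k + 1) :=
            Nat.mul_le_mul (le_trans (by norm_num) (Nat.pow_le_pow_left hr2 3)) h1
        _ = r ^ (k + 4) := by ring
    have h3 : (8 * m : ℝ) ≤ (r : ℝ) ^ (k + 4) := by exact_mod_cast h2
    have h4 := Real.log_le_log (by positivity) h3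
    rw [Real.log_pow] at h4
    exact_mod_cast h4
  have hratio : ((r : ℝ) / m) ^ (1 - p / 2) ≤
      ((r : ℝ) / (m + l : ℕ)) ^ (1 - p / 2) + 1 / d := by
    rcases min_choice (m + l) (r * d ^ k) with h1 | h1
    · rw [h1] at hm
      rw [← hm]
      have : (0 : ℝ) ≤ 1 / d := by positivity
      linarith
    · rw [h1] at hm
      have h2 : (r : ℝ) / m = (d : ℝ) ^ (-(k : ℝ)) := by
        rw [hm, Real.rpow_neg (by positivity), Real.rpow_natCast]
        push_cast
        field_simp
      have h3 : ((r : ℝ) / m) ^ (1 - p / 2) ≤ 1 / d := by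
        rw [h2, ← Real.rpow_mul (by positivity), one_div, ← Real.rpow_neg_one]
        refine Real.rpow_le_rpow_of_exponent_le hd' ?_
        rw [div_le_iff₀ (by linarith)] at hk
        nlinarith
      have : (0 : ℝ) ≤ ((r : ℝ) / (m + l : ℕ)) ^ (1 - p / 2) := by positivity
      linarith
  set Y := ((r : ℝ) / (m + l : ℕ)) ^ (1 - p / 2) with hY
  have hY0 : 0 ≤ Y := by positivity
  have hk0 : (0 : ℝ) ≤ k := k.cast_nonneg
  have hsum : Real.log (8 * m) / d + ((r : ℝ) / m) ^ (1 - p / 2) ≤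
      (2 * (k + 4) + 4) * (Real.log r ^ 2 / d + Y) := by
    have h1 : Real.log (8 * m) + 1 ≤ (2 * (k + 4) + 4) * Real.log r ^ 2 := by
      have h5 : Real.log r ≤ 2 * Real.log r ^ 2 := by nlinarith
      have h6 : (k + 4) * Real.log r ≤ (k + 4) * (2 * Real.log r ^ 2) := by gcongr
      nlinarith
    have h2 : Real.log (8 * m) / d + 1 / d ≤ (2 * (k + 4) + 4) * (Real.log r ^ 2 / d) := by
      rw [← add_div, ← mul_div_assoc]
      gcongr
    have h3 : Y ≤ (2 * (k + 4) + 4) * Y := by nlinarith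
    linarith
  calc (1 : ℝ) ≤ _ := hmain
    _ ≤ 100 * κ ^ p * ((2 * (k + 4) + 4) * (Real.log r ^ 2 / d + Y)) := by gcongr
    _ = _ := by ring

/-- The distortion bound in its general form. For `r ≥ n` it only says that `κ` is bounded below by
a constant. -/
theorem exists_distortion_lower_bound {p : ℝ} (hp1 : 1 ≤ p) (hp2 : p < 2) :
    ∃ c : ℝ, 0 < c ∧
      ∀ (n d r : ℕ), 0 < n → 0 < d → ¬ (r = 1 ∧ d = 1) →
      ∀ (κ : ℝ) (μ : MeasureTheory.Measure (Matrix (Fin r) (Fin n) ℝ)),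
        IsObliviousSubspaceEmbedding p κ r n d μ →
        c * (1 / ((1 / (d : ℝ)) ^ (1 / p) * Real.log r ^ (2 / p)
          + ((r : ℝ) / n) ^ (1 / p - 1 / 2))) ≤ κ := by
  have hp0 : 0 < p := by linarith
  obtain ⟨C, hC1, hC⟩ := exists_one_le_mul_log_sq_add hp1 hp2
  have hC0 : 0 < C := by linarith
  refine ⟨C⁻¹ ^ (1 / p), by positivity, ?_⟩
  intro n d r hn hd hrd κ μ h
  have hκ : 1 ≤ κ := h.one_le_distortion hp0 hn hd
  have hr : 0 < r := by
    by_contra! h0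
    have := h.dim_le_rows hp0 (by omega)
    omega
  have hr' : (0 : ℝ) < r := by exact_mod_cast hr
  have hn' : (0 : ℝ) < n := by exact_mod_cast hn
  have hlog : 0 ≤ Real.log r := Real.log_natCast_nonneg r
  have hs : 0 ≤ 1 / p - 1 / 2 := by
    have := one_div_le_one_div_of_le hp0 hp2.le
    linarith
  set X := (1 / (d : ℝ)) ^ (1 / p) * Real.log r ^ (2 / p) with hX
  set Y := ((r : ℝ) / n) ^ (1 / p - 1 / 2) with hY
  have hX0 : 0 ≤ X := by positivity
  have hY0 : 0 < Y := by positivity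
  rw [mul_one_div, div_le_iff₀ (by positivity)]
  rcases lt_or_ge r n with hrn | hrn
  · have hXp : X ^ p = Real.log r ^ 2 / d := by
      rw [hX, Real.mul_rpow (by positivity) (by positivity), ← Real.rpow_mul (by positivity),
        ← Real.rpow_mul hlog, one_div_mul_cancel hp0.ne', div_mul_cancel₀ _ hp0.ne', Real.rpow_one,
        Real.rpow_two]
      ring
    have hYp : Y ^ p = ((r : ℝ) / n) ^ (1 - p / 2) := by
      rw [hY, ← Real.rpow_mul (by positivity)]
      congr 1
      field_simp
    have h1 := hC n d r hn hd hrd hrn κ μ h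
    rw [← hXp, ← hYp] at h1
    have h2 : X ^ p + Y ^ p ≤ (X + Y) ^ p := Real.add_rpow_le_rpow_add hX0 hY0.le hp1
    have h3 : C⁻¹ ≤ (κ * (X + Y)) ^ p := by
      rw [Real.mul_rpow (by linarith) (by positivity), inv_le_iff_one_le_mul₀ hC0]
      calc 1 ≤ _ := h1
        _ ≤ C * κ ^ p * (X + Y) ^ p := by gcongr
        _ = _ := by ring
    calc C⁻¹ ^ (1 / p) ≤ ((κ * (X + Y)) ^ p) ^ (1 / p) := by gcongr
      _ = κ * (X + Y) := by
        rw [← Real.rpow_mul (by positivity), mul_one_div_cancel hp0.ne', Real.rpow_one]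
  · have h1 : 1 ≤ Y := Real.one_le_rpow ((one_le_div hn').2 (by exact_mod_cast hrn)) hs
    have h2 : C⁻¹ ^ (1 / p) ≤ 1 :=
      Real.rpow_le_one (by positivity) (inv_le_one_of_one_le₀ hC1) (by positivity)
    nlinarith

theorem theorem1 (p : ℝ) (hp1 : 1 ≤ p) (hp2 : p < 2) :
    -- The distortion lower bound, with a constant that depends only on `p`.
    (∃ c : ℝ, 0 < c ∧
      ∀ (n d r : ℕ), 0 < n → 0 < d → ¬ (r = 1 ∧ d = 1) →
      ∀ (κ : ℝ) (μ : MeasureTheory.Measure (Matrix (Fin r) (Fin n) ℝ)),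
        IsObliviousSubspaceEmbedding p κ r n d μ →
        c * (1 / ((1 / (d : ℝ)) ^ (1 / p) * Real.log r ^ (2 / p)
          + ((r : ℝ) / n) ^ (1 / p - 1 / 2))) ≤ κ) ∧
    -- The regime in which `r` is polynomially bounded in `d` and `n` is large compared with `r`.
    (∀ a : ℕ, ∃ c : ℝ, 0 < c ∧
      ∀ (n d r : ℕ), 0 < n → 2 ≤ d → r ≤ d ^ a →
        (r : ℝ) * (d : ℝ) ^ (2 / (2 - p)) ≤ n →
      ∀ (κ : ℝ) (μ : MeasureTheory.Measure (Matrix (Fin r) (Fin n) ℝ)),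
        IsObliviousSubspaceEmbedding p κ r n d μ →
        c * ((d : ℝ) ^ (1 / p) / Real.log d ^ (2 / p)) ≤ κ) := by
  have hp0 : 0 < p := by linarith
  refine ⟨exists_distortion_lower_bound hp1 hp2, fun a => ?_⟩
  obtain ⟨c, hc, hbound⟩ := exists_distortion_lower_bound hp1 hp2
  have hl2 : 0 < Real.log 2 := Real.log_pos (by norm_num)
  obtain ⟨D, hD⟩ : ∃ D : ℝ, D = (a : ℝ) ^ (2 / p) + (Real.log 2)⁻¹ ^ (2 / p) := ⟨_, rfl⟩
  have hD0 : 0 < D := by rw [hD]; positivity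
  refine ⟨c / D, by positivity, ?_⟩
  intro n d r hn hd hra hrn κ μ h
  refine le_trans ?_ (hbound n d r hn (by omega) (by omega) κ μ h)
  have hr : 0 < r := by
    by_contra! h0
    have := h.dim_le_rows hp0 (by omega)
    omega
  have hr' : (0 : ℝ) < r := by exact_mod_cast hr
  have hn' : (0 : ℝ) < n := by exact_mod_cast hn
  have hd2 : (2 : ℝ) ≤ d := by exact_mod_cast hd
  have hd0 : (0 : ℝ) < d := by linarith
  have hL : Real.log 2 ≤ Real.log d := Real.log_le_log (by norm_num) hd2
  have hL0 : 0 < Real.log d := by linarith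
  have hs : 0 ≤ 1 / p - 1 / 2 := by
    have := one_div_le_one_div_of_le hp0 hp2.le
    linarith
  have hlogr : Real.log r ≤ a * Real.log d := by
    rw [← Real.log_pow]
    exact Real.log_le_log hr' (by exact_mod_cast hra)
  have hX : Real.log r ^ (2 / p) ≤ (a : ℝ) ^ (2 / p) * Real.log d ^ (2 / p) := by
    rw [← Real.mul_rpow (by positivity) hL0.le]
    exact Real.rpow_le_rpow (Real.log_natCast_nonneg r) hlogr (by positivity)
  have hone : 1 ≤ (Real.log 2)⁻¹ ^ (2 / p) * Real.log d ^ (2 / p) := by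
    rw [← Real.mul_rpow (by positivity) hL0.le]
    refine Real.one_le_rpow ?_ (by positivity)
    rw [inv_mul_eq_div, one_le_div hl2]
    exact hL
  have hY : ((r : ℝ) / n) ^ (1 / p - 1 / 2) ≤ (1 / (d : ℝ)) ^ (1 / p) := by
    have h1 : (r : ℝ) / n ≤ (1 / (d : ℝ)) ^ (2 / (2 - p)) := by
      rw [one_div, Real.inv_rpow hd0.le, div_le_iff₀ hn', ← div_eq_inv_mul,
        le_div_iff₀ (by positivity)]
      exact hrn
    calc _ ≤ ((1 / (d : ℝ)) ^ (2 / (2 - p))) ^ (1 / p - 1 / 2) := by gcongr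
      _ = _ := by
        rw [← Real.rpow_mul (by positivity)]
        congr 1
        have : 2 - p ≠ 0 := by linarith
        field_simp
  have hsum : (1 / (d : ℝ)) ^ (1 / p) * Real.log r ^ (2 / p) + ((r : ℝ) / n) ^ (1 / p - 1 / 2) ≤
      (1 / (d : ℝ)) ^ (1 / p) * (D * Real.log d ^ (2 / p)) := by
    rw [hD]
    have h0 : 0 ≤ (1 / (d : ℝ)) ^ (1 / p) := by positivity
    nlinarith [mul_le_mul_of_nonneg_left hX h0, mul_le_mul_of_nonneg_left hone h0]
  have hpos : 0 < (1 / (d : ℝ)) ^ (1 / p) * Real.log r ^ (2 / p) +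
      ((r : ℝ) / n) ^ (1 / p - 1 / 2) := by
    have h1 : 0 ≤ Real.log r := Real.log_natCast_nonneg r
    positivity
  calc c / D * ((d : ℝ) ^ (1 / p) / Real.log d ^ (2 / p))
      = c * (1 / ((1 / (d : ℝ)) ^ (1 / p) * (D * Real.log d ^ (2 / p)))) := by
        rw [one_div (d : ℝ), Real.inv_rpow hd0.le]
        field_simp
    _ ≤ _ := by gcongr
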